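/- Let $K$ be a number field, $C/K$ a smooth, proper, (geometrically) irreducible curve with a rational base point $Q\in C(K)$, $J$ its Jacobian, $\iota:C\to J$, $\iota(P)=[P-Q]$ the Abel–Jacobi map, and $\psi:C\to\mathbb P^1$ a morphism defined over $K$. Put $H=\{P\in C(K):\psi(P)\in\mathbb P^1(\mathbb Q)\}$. Let $L\le J(K)$ be a subgroup of finite index $N$, and let $p_0,\dots,p_b$ be rational primes such that for $0\le i\le b$: (i) $p_i$ is unramified in $\mathcal O_K$; (ii) for every prime $\mathfrak p\mid p_i$ of $\mathcal O_K$ the curve $C$ has good reduction at $\mathfrak p$, and $\psi$ extends to a morphism to $\mathbb P^1$ of a smooth proper model of $C$ over the local ring at $\mathfrak p$; on the special fibre it induces the reduced map $\overline{\psi^{\mathfrak p}}$; (iii) $\#\prod_{\mathfrak p\mid p_i}J(k_{\mathfrak p})$ is coprime to $N$, where $k_{\mathfrak p}$ is the residue field at $\mathfrak p$ and $J(k_{\mathfrak p})$ denotes the $k_{\mathfrak p}$-points of the Jacobian of the reduced curve. Let $\mathrm{red}_{p_i}$ denote the reduction maps $C(K)\to\prod_{\mathfrak p\mid p_i}C(k_{\mathfrak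 p})$ and $J(K)\to\prod_{\mathfrak p\mid p_i}J(k_{\mathfrak p})$ (the latter a homomorphism), let $\iota$ also denote the Abel–Jacobi map $\prod_{\mathfrak p\mid p_i}C(k_{\mathfrak p})\to\prod_{\mathfrak p\mid p_i}J(k_{\mathfrak p})$ with base point $\mathrm{red}_{p_i}(Q)$, and let $$\mathcal G_i=\Big\{\mathcal P\in\prod_{\mathfrak p\mid p_i}C(k_{\mathfrak p}) : \overline{\psi^{\mathfrak p}}(\mathcal P_{\mathfrak p})=\overline{\psi^{\mathfrak q}}(\mathcal P_{\mathfrak q})\in\mathbb P^1(\mathbb F_{p_i})\ \text{ for all }\mathfrak p,\mathfrak q\mid p_i\Big\}.$$ Put $L_0=L\cap\ker(\mathrm{red}_{p_0})$ and $L_i=L_{i-1}\cap\ker(\mathrm{red}_{p_i})$ for $1\le i\le b$. For $\mathcal P\in\mathcal G_0$ let $$W_{0,\mathcal P}=\{w\in L/L_0:\mathrm{red}_{p_0}(w)=\iota(\mathcal P)\},$$ and for $1\le i\le b$ let $W_{i,\mathcal P}\subseteq L/L_i$ be the set of classes of $w+l$, where $w\in L$ represents an element of $W_{i-1,\mathcal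 P}\subseteq L/L_{i-1}$, $l\in L_{i-1}$, and $\mathrm{red}_{p_i}(w+l)\in\iota(\mathcal G_i)$. If $\mathcal P\in\mathcal G_0$ and $W_{b,\mathcal P}=\emptyset$, then no $P\in H$ satisfies $\mathrm{red}_{p_0}(P)=\mathcal P$. -/

import Mathlib

open CategoryTheory CategoryTheory.Limits AlgebraicGeometry

noncomputable section

/-! ### Curves over a field, divisors and the degree-zero divisor class group -/

/-- A smooth proper integral curve over the field `k`. -/
structure Curve (k : Type) [Field k] where
  /-- the underlying scheme -/
  X : Scheme.{0}
  /-- the structure morphism -/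
  str : X ⟶ Spec (.of k)
  [integral : IsIntegral X]
  [proper : IsProper str]
  [smooth : SmoothOfRelativeDimension 1 str]

namespace Curve

attribute [instance] Curve.integral Curve.proper Curve.smooth

variable {k : Type} [Field k] (C : Curve k)

instance isLocallyNoetherian : IsLocallyNoetherian C.X :=
  LocallyOfFiniteType.isLocallyNoetherian C.str

/-- The `k`-rational points `C(k)`. -/
@[ext]
structure Point where
  /-- the underlying section of the structure morphism -/
  hom : Spec (.of k) ⟶ C.X
  comp_str : hom ≫ C.str = 𝟙 _

/-- The closed points of the curve, i.e. its prime divisors. -/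
abbrev ClosedPoint : Type := {x : C.X // IsClosed ({x} : Set C.X)}

/-- Divisors on `C`: finite formal sums of closed points. -/
abbrev Div : Type := C.ClosedPoint →₀ ℤ

/-- The degree `∑ n_x [κ(x) : k]` of a divisor. -/
def degree : C.Div →+ ℤ :=
  Finsupp.liftAddHom fun x => AddMonoidHom.mulRight (C.str.residueDegree x.1 : ℤ)

/-- The principal divisors: the divisors of the nonzero rational functions. -/
def principal : AddSubgroup C.Div where
  carrier := {D | ∃ f : C.X.functionField, f ≠ 0 ∧ ∀ x, D x = Scheme.ord f x.1}
  zero_mem' := by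
    refine ⟨1, one_ne_zero, fun x => ?_⟩
    have h := Scheme.ord_mul (x := x.1) (one_ne_zero (α := C.X.functionField)) one_ne_zero
    simp only [mul_one] at h
    simp only [Finsupp.coe_zero, Pi.zero_apply]
    omega
  add_mem' := by
    rintro D E ⟨f, hf, hD⟩ ⟨g, hg, hE⟩
    exact ⟨f * g, mul_ne_zero hf hg, fun x => by
      rw [Finsupp.add_apply, hD, hE, Scheme.ord_mul hf hg]⟩
  neg_mem' := by
    rintro D ⟨f, hf, hD⟩
    refine ⟨f⁻¹, inv_ne_zero hf, fun x => ?_⟩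
    have h := Scheme.ord_mul (x := x.1) hf (inv_ne_zero hf)
    have h' := Scheme.ord_mul (x := x.1) (one_ne_zero (α := C.X.functionField)) one_ne_zero
    rw [mul_inv_cancel₀ hf] at h
    simp only [mul_one] at h'
    rw [Finsupp.neg_apply, hD]
    omega

/-- The divisors of degree zero. -/
abbrev Div0 : AddSubgroup C.Div := C.degree.ker

/-- The group `Pic⁰(C)` of divisor classes of degree zero. For a curve with a rational point, this
is the group `J(k)` of rational points of the Jacobian `J` of `C`. -/
abbrev Jac : Type := C.Div0 ⧸ C.principal.addSubgroupOf C.Div0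

/-- The class of a divisor of degree zero. -/
def cls : C.Div0 →+ C.Jac := QuotientAddGroup.mk' _

variable {C}

theorem Point.isClosed_apply (P : C.Point) (s : Spec (.of k)) :
    IsClosed ({P.hom s} : Set C.X) := by
  have : IsClosedImmersion (P.hom ≫ C.str) := by rw [P.comp_str]; infer_instance
  have : IsClosedImmersion P.hom := IsClosedImmersion.of_comp P.hom C.str
  have : IsClosed ({s} : Set (Spec (.of k))) := by
    rw [Set.eq_univ_of_forall (s := {s}) fun x => Subsingleton.elim (α := PrimeSpectrum k) x s]
    exact isClosed_univ
  simpa only [Set.image_singleton] using P.hom.isClosedEmbedding.isClosedMap _ this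

theorem Point.residueDegree_apply (P : C.Point) (s : Spec (.of k)) :
    C.str.residueDegree (P.hom s) = 1 := by
  have h₁ : Function.Bijective ((P.hom ≫ C.str).residueFieldMap s).hom := by
    have h : IsIso (P.hom ≫ C.str) := by rw [P.comp_str]; infer_instance
    exact ConcreteCategory.bijective_of_isIso ((P.hom ≫ C.str).residueFieldMap s)
  rw [Scheme.residueFieldMap_comp] at h₁
  have hs : Function.Surjective (C.str.residueFieldMap (P.hom s)).hom := by
    intro a
    obtain ⟨c, hc⟩ := h₁.2 ((P.hom.residueFieldMap s).hom a)
    exact ⟨c, (P.hom.residueFieldMap s).hom.injective hc⟩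
  let _ := (C.str.residueFieldMap (P.hom s)).hom.toAlgebra
  have := (AlgEquiv.ofBijective (Algebra.ofId
    ((Spec (.of k)).residueField (C.str (P.hom s))) (C.X.residueField (P.hom s)))
    ⟨(C.str.residueFieldMap (P.hom s)).hom.injective, hs⟩).toLinearEquiv.finrank_eq
  rw [CommSemiring.finrank_self] at this
  exact this.symm

/-- The closed point of `C` underlying a rational point. -/
def Point.toClosedPoint (P : C.Point) : C.ClosedPoint :=
  ⟨P.hom (IsLocalRing.closedPoint k), P.isClosed_apply _⟩

theorem Point.residueDegree_eq_one (P : C.Point) :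
    C.str.residueDegree P.toClosedPoint.1 = 1 :=
  P.residueDegree_apply _

/-- The Abel-Jacobi map `P ↦ [P - Q]` with base point `Q`. -/
def abelJacobi (Q P : C.Point) : C.Jac :=
  C.cls ⟨Finsupp.single P.toClosedPoint 1 - Finsupp.single Q.toClosedPoint 1, by
    rw [AddMonoidHom.mem_ker, map_sub, degree, Finsupp.liftAddHom_apply_single,
      Finsupp.liftAddHom_apply_single]
    simp [Point.residueDegree_eq_one]⟩

end Curve

/-! ### Primes of a number field and models with good reduction -/

variable {K : Type} [Field K] [NumberField K]

open NumberField IsDedekindDomain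

/-- The primes of `𝓞 K` above the rational prime `p`. -/
abbrev PrimesAbove (K : Type) [Field K] [NumberField K] (p : ℕ) : Type :=
  {𝔭 : HeightOneSpectrum (𝓞 K) // (p : 𝓞 K) ∈ 𝔭.asIdeal}

/-- The local ring of `𝓞 K` at `𝔭`, as the subring of `𝔭`-integral elements of `K`. -/
abbrev LocalInt (𝔭 : HeightOneSpectrum (𝓞 K)) : ValuationSubring K :=
  (𝔭.valuation K).valuationSubring

/-- The residue field `k_𝔭`. -/
abbrev ResField (𝔭 : HeightOneSpectrum (𝓞 K)) : Type :=
  IsLocalRing.ResidueField (LocalInt 𝔭)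

/-- `Spec K ⟶ Spec 𝓞_{K,𝔭}`. -/
abbrev specGeneric (𝔭 : HeightOneSpectrum (𝓞 K)) :
    Spec (.of K) ⟶ Spec (.of (LocalInt 𝔭)) :=
  Spec.map (CommRingCat.ofHom (algebraMap (LocalInt 𝔭) K))

/-- `Spec k_𝔭 ⟶ Spec 𝓞_{K,𝔭}`. -/
abbrev specSpecial (𝔭 : HeightOneSpectrum (𝓞 K)) :
    Spec (.of (ResField 𝔭)) ⟶ Spec (.of (LocalInt 𝔭)) :=
  Spec.map (CommRingCat.ofHom (IsLocalRing.residue (LocalInt 𝔭)))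

/-- A model witnessing that `C` has good reduction at `𝔭`: a smooth proper scheme over the local
ring at `𝔭` whose generic fibre is `C` and whose special fibre is again a curve. -/
structure GoodModel (C : Curve K) (𝔭 : HeightOneSpectrum (𝓞 K)) where
  /-- the total space -/
  X : Scheme.{0}
  /-- the structure morphism -/
  str : X ⟶ Spec (.of (LocalInt 𝔭))
  /-- the inclusion of the generic fibre -/
  gen : C.X ⟶ X
  [proper : IsProper str]
  [smooth : SmoothOfRelativeDimension 1 str]
  isPullback : IsPullback gen C.str str (specGeneric 𝔭)
  [integral_special : IsIntegral (pullback str (specSpecial 𝔭))]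

namespace GoodModel

attribute [instance] GoodModel.proper GoodModel.smooth GoodModel.integral_special

variable {C : Curve K} {𝔭 : HeightOneSpectrum (𝓞 K)} (M : GoodModel C 𝔭)

/-- The reduction of the curve: the special fibre of the model. -/
def special : Curve (ResField 𝔭) where
  X := pullback M.str (specSpecial 𝔭)
  str := pullback.snd M.str (specSpecial 𝔭)
  integral := M.integral_special
  proper := inferInstance
  smooth := (smoothOfRelativeDimension_isStableUnderBaseChange 1).of_isPullback
    (IsPullback.of_hasPullback M.str (specSpecial 𝔭)) M.smooth

/-- The inclusion of the special fibre in the model. -/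
def inclSpecial : M.special.X ⟶ M.X := pullback.fst M.str (specSpecial 𝔭)

theorem exists_lift (P : C.Point) : ∃ s : Spec (.of (LocalInt 𝔭)) ⟶ M.X,
    specGeneric 𝔭 ≫ s = P.hom ≫ M.gen ∧ s ≫ M.str = 𝟙 _ := by
  have hsq : CommSq (P.hom ≫ M.gen)
      (Spec.map (CommRingCat.ofHom (algebraMap (LocalInt 𝔭) K))) M.str (𝟙 _) :=
    ⟨by rw [Category.assoc, M.isPullback.w, ← Category.assoc, P.comp_str, Category.id_comp,
      Category.comp_id]⟩
  have hV : ValuativeCriterion M.str := by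
    have h := M.proper
    rw [IsProper.eq_valuativeCriterion] at h
    exact h.1.1.1
  obtain ⟨⟨l, h₁, h₂⟩⟩ := (hV.existence
    { R := LocalInt 𝔭, K := K, i₁ := P.hom ≫ M.gen, i₂ := 𝟙 _, commSq := hsq }).exists_lift
  exact ⟨l, h₁, h₂⟩

/-- The extension of a rational point of `C` to a section of the model; it exists by the valuative
criterion of properness, and is unique since the model is separated. -/
def lift (P : C.Point) : Spec (.of (LocalInt 𝔭)) ⟶ M.X := (M.exists_lift P).choose

theorem lift_str (P : C.Point) : M.lift P ≫ M.str = 𝟙 _ := (M.exists_lift P).choose_spec.2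

/-- The reduction map `red_𝔭 : C(K) → C(k_𝔭)`. -/
def redPoint (P : C.Point) : M.special.Point :=
  ⟨pullback.lift (specSpecial 𝔭 ≫ M.lift P) (𝟙 _)
    (by rw [Category.assoc, M.lift_str, Category.comp_id, Category.id_comp]),
    pullback.lift_snd _ _ _⟩

open Classical in
/-- The ideal, in the local ring of the model at the point `z`, of the closure of the point `x` of
the generic fibre; it is the unit ideal if `z` does not lie on this closure. -/
def closureIdeal (x : C.X) (z : M.X) : Ideal (M.X.presheaf.stalk z) :=
  if h : M.gen x ⤳ z then
    (IsLocalRing.maximalIdeal (M.X.presheaf.stalk (M.gen x))).comap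
      (M.X.presheaf.stalkSpecializes h).hom
  else ⊤

/-- The multiplicity at `y` of the intersection of the closure of `x` with the special fibre: the
length of the local ring of the special fibre at `y` modulo the ideal of the closure of `x`. -/
def mult (x : C.ClosedPoint) (y : M.special.ClosedPoint) : ℕ :=
  (Module.length (M.special.X.presheaf.stalk y.1)
    (M.special.X.presheaf.stalk y.1 ⧸
      (M.closureIdeal x.1 (M.inclSpecial y.1)).map (M.inclSpecial.stalkMap y.1).hom)).toNat

/-- `D'` is the specialization of the divisor `D`: the intersection with the special fibre of the
closure of `D` in the model. -/
def Specializes (D : C.Div) (D' : M.special.Div) : Prop :=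
  ∀ y, D' y = D.sum fun x n => n * (M.mult x y : ℤ)

/-- The graph of the reduction homomorphism `red_𝔭 : J(K) → J(k_𝔭)`, which sends the class of a
divisor of degree zero to the class of its specialization. As the model is regular and its special
fibre is an irreducible principal divisor, every class has exactly one reduction. -/
def redGraph : AddSubgroup (C.Jac × M.special.Jac) where
  carrier := {a | ∃ (D : C.Div0) (D' : M.special.Div0), M.Specializes D.1 D'.1 ∧
    C.cls D = a.1 ∧ M.special.cls D' = a.2}
  zero_mem' := ⟨0, 0, fun y => by simp, by simp, by simp⟩
  add_mem' := by
    rintro a a' ⟨D, D', h, h₁, h₂⟩ ⟨E, E', g, g₁, g₂⟩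
    refine ⟨D + E, D' + E', fun y => ?_, by simp [h₁, g₁], by simp [h₂, g₂]⟩
    have hs := Finsupp.sum_add_index' (f := D.1) (g := E.1)
      (h := fun x n => n * (M.mult x y : ℤ)) (fun _ => by simp) (fun _ _ _ => by ring)
    simp only [AddSubgroup.coe_add, Finsupp.add_apply, h y, g y, hs]
  neg_mem' := by
    rintro a ⟨D, D', h, h₁, h₂⟩
    refine ⟨-D, -D', fun y => ?_, by simp [h₁], by simp [h₂]⟩
    have hs := Finsupp.sum_neg_index (g := D.1)
      (h := fun x n => n * (M.mult x y : ℤ)) (fun _ => by simp)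
    simp only [AddSubgroup.coe_neg, Finsupp.neg_apply, h y, hs]
    simp [Finsupp.sum]

end GoodModel

/-! ### The projective line -/

/-- The projective line over `ℤ`. As `ℙ¹_S = ℙ¹ ×_ℤ S`, the `S`-morphisms `T ⟶ ℙ¹_S` of
`S`-schemes are the morphisms `T ⟶ ℙ¹`; in particular `ℙ¹(R)` is the set of morphisms
`Spec R ⟶ ℙ¹`. -/
def ProjLine : Scheme.{0} :=
  letI := MvPolynomial.gradedAlgebra (σ := Fin 2) (R := ℤ)
  Proj (MvPolynomial.homogeneousSubmodule (Fin 2) ℤ)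

theorem natCast_residue_eq_zero {p : ℕ} (𝔭 : PrimesAbove K p) :
    (p : ResField 𝔭.1) = 0 := by
  have h : (𝔭.1.valuation K) (p : K) < 1 := by
    have := (𝔭.1.valuation_lt_one_iff_mem (K := K) (p : 𝓞 K)).2 𝔭.2
    simpa using this
  have h' : (p : LocalInt 𝔭.1) ∈ IsLocalRing.maximalIdeal (LocalInt 𝔭.1) := by
    rw [ValuationSubring.valuation_lt_one_iff]
    exact (Valuation.isEquiv_valuation_valuationSubring (𝔭.1.valuation K)).lt_one_iff_lt_one.1
      (by simpa using h)
  have := (IsLocalRing.residue_eq_zero_iff (p : LocalInt 𝔭.1)).2 h'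
  simpa using this

/-- The inclusion `𝔽_p → k_𝔭` for `𝔭 ∣ p`. -/
def primeFieldHom {p : ℕ} (𝔭 : PrimesAbove K p) : ZMod p →+* ResField 𝔭.1 :=
  (Ideal.Quotient.lift (Ideal.span {(p : ℤ)}) (Int.castRingHom (ResField 𝔭.1)) (by
    intro a ha
    obtain ⟨c, rfl⟩ := Ideal.mem_span_singleton.1 ha
    simp [natCast_residue_eq_zero 𝔭])).comp
    (Int.quotientSpanNatEquivZMod p).symm.toRingHom

/-- The set `H` of the points of `C(K)` whose image under `ψ` lies in `ℙ¹(ℚ)`. -/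
def pointsOverRat (C : Curve K) (ψ : C.X ⟶ ProjLine) : Set C.Point :=
  {P | ∃ t : Spec (.of ℚ) ⟶ ProjLine,
    P.hom ≫ ψ = Spec.map (CommRingCat.ofHom (algebraMap ℚ K)) ≫ t}

/-! ### Reduction modulo a rational prime -/

section AtPrime

variable {C : Curve K} {p : ℕ} (M : ∀ 𝔭 : PrimesAbove K p, GoodModel C 𝔭.1)

/-- `∏_{𝔭 ∣ p} C(k_𝔭)`. -/
abbrev PointsMod : Type := ∀ 𝔭 : PrimesAbove K p, (M 𝔭).special.Point

/-- `∏_{𝔭 ∣ p} J(k_𝔭)`. -/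
abbrev JacMod : Type := ∀ 𝔭 : PrimesAbove K p, (M 𝔭).special.Jac

/-- The reduction map `red_p : C(K) → ∏_{𝔭 ∣ p} C(k_𝔭)`. -/
def redMod (P : C.Point) : PointsMod M := fun 𝔭 => (M 𝔭).redPoint P

/-- The residue class `ℬ_p(𝓟)`: the points of `C(K)` reducing to `𝓟`. -/
def residueClass (𝓟 : PointsMod M) : Set C.Point := {P | redMod M P = 𝓟}

/-- The graph of the reduction homomorphism `red_p : J(K) → ∏_{𝔭 ∣ p} J(k_𝔭)`. -/
def redGraphMod : AddSubgroup (C.Jac × JacMod M) where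
  carrier := {a | ∀ 𝔭, (a.1, a.2 𝔭) ∈ (M 𝔭).redGraph}
  zero_mem' := fun 𝔭 => (M 𝔭).redGraph.zero_mem
  add_mem' := fun ha hb 𝔭 => (M 𝔭).redGraph.add_mem (ha 𝔭) (hb 𝔭)
  neg_mem' := fun ha 𝔭 => (M 𝔭).redGraph.neg_mem (ha 𝔭)

/-- The Abel-Jacobi map `∏_{𝔭 ∣ p} C(k_𝔭) → ∏_{𝔭 ∣ p} J(k_𝔭)`, with the reductions of `Q` as base
points. -/
def abelJacobiMod (Q : C.Point) (𝓟 : PointsMod M) : JacMod M :=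
  fun 𝔭 => Curve.abelJacobi ((M 𝔭).redPoint Q) (𝓟 𝔭)

/-- The set `𝒢` of the `𝓟` in `∏_{𝔭 ∣ p} C(k_𝔭)` whose components all have the same image in
`ℙ¹(𝔽_p)` under the reductions of `ψ`; here `Ψ 𝔭` extends `ψ` to the model at `𝔭`. -/
def goodTuples (Ψ : ∀ 𝔭 : PrimesAbove K p, (M 𝔭).X ⟶ ProjLine) : Set (PointsMod M) :=
  {𝓟 | ∃ t : Spec (.of (ZMod p)) ⟶ ProjLine, ∀ 𝔭,
    (𝓟 𝔭).hom ≫ (M 𝔭).inclSpecial ≫ Ψ 𝔭 =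
      Spec.map (CommRingCat.ofHom (primeFieldHom 𝔭)) ≫ t}

end AtPrime

/-! ### The sieve -/

section Sieve

variable {A : Type} [AddCommGroup A] {b : ℕ} {B : Fin (b + 1) → Type}
  [∀ i, AddCommGroup (B i)] (L : AddSubgroup A) (Γ : ∀ i, AddSubgroup (A × B i))

/-- The groups `L_0 = L ∩ ker red_0` and `L_i = L_{i-1} ∩ ker red_i`, where `Γ i` is the graph of
the homomorphism `red_i : A → B i`. -/
def sieveSubgroup : Fin (b + 1) → AddSubgroup A :=
  Fin.induction (L ⊓ (Γ 0).comap (AddMonoidHom.inl A (B 0)))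
    fun i Li => Li ⊓ (Γ i.succ).comap (AddMonoidHom.inl A (B i.succ))

/-- The candidate sets `W_i ⊆ L / L_i`: `W_0` consists of the classes whose reduction is `z`, and
`W_i` of the classes of the `w + l` with `w` a representative of an element of `W_{i-1}` and
`l ∈ L_{i-1}` such that the reduction of `w + l` lies in `S i`. -/
def sieveSet (z : B 0) (S : ∀ i, Set (B i)) :
    ∀ i, Set (L ⧸ (sieveSubgroup L Γ i).addSubgroupOf L) :=
  Fin.induction
    {v | ∃ x : L, QuotientAddGroup.mk x = v ∧ ((x : A), z) ∈ Γ 0}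
    fun i Wi =>
      {v | ∃ w l : L, QuotientAddGroup.mk w ∈ Wi ∧ (l : A) ∈ sieveSubgroup L Γ i.castSucc ∧
        QuotientAddGroup.mk (w + l) = v ∧ ∃ y ∈ S i.succ, (((w + l : L) : A), y) ∈ Γ i.succ}

end Sieve

end

section

open NumberField IsDedekindDomain

variable {K : Type} [Field K] [NumberField K]

/-! ### Points of the projective line -/

namespace ProjLine

/-! A point P of H reducing to 𝓟 would produce a class that survives every stage of the sieve. The
class [P - Q] need not lie in L. By Bézout, there is an integer v such that v * N is congruent to 1
modulo the product of the orders of the groups `JacMod (M i)`. Then w = v * N * [P - Q] lies in L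
and has the same reductions as [P - Q] (`exists_mem_of_coprime_index`). This single w represents an
element of every W_i, with l = 0 at each stage (`exists_mem_sieveSet`). Two compatibilities make
this work. The reduction of P is a good tuple, because a ℚ-point of ℙ¹ extends over ℤ_(p) and its
𝔽_p-point does not depend on 𝔭 (`redMod_mem_goodTuples`). Also [P - Q] reduces to the class of the
reduced points, because the section through P meets the special fibre only at the reduction of P,
with multiplicity one (`abelJacobi_mem_redGraph`). Only the additivity of the reduction relation on
J is used, not its single-valuedness. -/

instance isSeparated : ProjLine.IsSeparated :=
  letI := MvPolynomial.gradedAlgebra (σ := Fin 2) (R := ℤ)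
  inferInstanceAs (Scheme.IsSeparated (Proj (MvPolynomial.homogeneousSubmodule (Fin 2) ℤ)))

/-- A point of the projective line over a valuation ring is determined by its restriction to the
fraction field. -/
theorem hom_ext_of_fractionField {R F : Type} [CommRing R] [IsDomain R] [Field F] [Algebra R F]
    [IsFractionRing R F] {f g : Spec (.of R) ⟶ ProjLine}
    (h : Spec.map (CommRingCat.ofHom (algebraMap R F)) ≫ f =
      Spec.map (CommRingCat.ofHom (algebraMap R F)) ≫ g) [ValuationRing R] : f = g := by
  -- Both `f` and `g` fill this square, and separatedness allows at most one filler.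
  let S : ValuativeCommSq (terminal.from ProjLine) :=
    { R := R, K := F, i₁ := Spec.map (CommRingCat.ofHom (algebraMap R F)) ≫ f
      i₂ := terminal.from _, commSq := ⟨Subsingleton.elim _ _⟩ }
  have hS := IsSeparated.valuativeCriterion (terminal.from ProjLine) S
  let l₁ : S.commSq.LiftStruct := ⟨f, rfl, Subsingleton.elim _ _⟩
  let l₂ : S.commSq.LiftStruct := ⟨g, h.symm, Subsingleton.elim _ _⟩
  exact congrArg CommSq.LiftStruct.l (hS.elim l₁ l₂)

/-- Every element of degree zero of `ℤ[X₀, X₁]` is an integer. -/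
theorem intCast_surjective_degreeZero :
    letI := MvPolynomial.gradedAlgebra (σ := Fin 2) (R := ℤ)
    Function.Surjective (Int.castRingHom (MvPolynomial.homogeneousSubmodule (Fin 2) ℤ 0)) := by
  let := MvPolynomial.gradedAlgebra (σ := Fin 2) (R := ℤ)
  rintro ⟨a, ha⟩
  have h := (MvPolynomial.totalDegree_zero_iff_isHomogeneous _).2
    ((MvPolynomial.mem_homogeneousSubmodule _ _).1 ha)
  refine ⟨MvPolynomial.coeff 0 a, Subtype.ext ?_⟩
  rw [MvPolynomial.totalDegree_eq_zero_iff_eq_C] at h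
  refine Eq.trans ?_ h.symm
  simp only [eq_intCast]
  exact map_intCast (algebraMap (MvPolynomial.homogeneousSubmodule (Fin 2) ℤ 0)
    (MvPolynomial (Fin 2) ℤ)) _

/-- A point of the projective line over the fraction field of a valuation ring extends to the
valuation ring. -/
theorem exists_extension {R F : Type} [CommRing R] [IsDomain R] [ValuationRing R] [Field F]
    [Algebra R F] [IsFractionRing R F] (t : Spec (.of F) ⟶ ProjLine) :
    ∃ t' : Spec (.of R) ⟶ ProjLine,
      Spec.map (CommRingCat.ofHom (algebraMap R F)) ≫ t' = t := by
  let := MvPolynomial.gradedAlgebra (σ := Fin 2) (R := ℤ)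
  let 𝒜 := MvPolynomial.homogeneousSubmodule (Fin 2) ℤ
  have : IsScalarTower ℤ (𝒜 0) (MvPolynomial (Fin 2) ℤ) :=
    ⟨fun n a x => by
      change ((n • a : 𝒜 0) : MvPolynomial (Fin 2) ℤ) * x = n • ((a : MvPolynomial (Fin 2) ℤ) * x)
      rw [AddSubgroupClass.coe_zsmul, smul_mul_assoc]⟩
  have : Algebra.FiniteType (𝒜 0) (MvPolynomial (Fin 2) ℤ) :=
    Algebra.FiniteType.of_restrictScalars_finiteType ℤ _ _
  -- The degree-zero ring is a quotient of ℤ, so it has at most one ring map to any given ring;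
  -- hence the square below commutes for every `t`.
  let c : 𝒜 0 →+* R := (Int.castRingHom R).comp
    ((MvPolynomial.constantCoeff (σ := Fin 2)).comp (algebraMap (𝒜 0) (MvPolynomial (Fin 2) ℤ)))
  have hsq : CommSq t (Spec.map (CommRingCat.ofHom (algebraMap R F))) (Proj.toSpecZero 𝒜)
      (Spec.map (CommRingCat.ofHom c)) := by
    constructor
    obtain ⟨a, ha⟩ := Spec.map_surjective (t ≫ Proj.toSpecZero 𝒜)
    rw [← Spec.map_comp]
    refine ha.symm.trans (congrArg Spec.map ?_)
    ext x
    obtain ⟨n, rfl⟩ := intCast_surjective_degreeZero x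
    simp
  obtain ⟨⟨l, h, -⟩⟩ := (Proj.valuativeCriterion_existence 𝒜
    { R := R, K := F, i₁ := t, i₂ := _, commSq := hsq }).exists_lift
  exact ⟨l, h⟩

end ProjLine

/-! ### Reduction of points over `ℙ¹(ℚ)` -/

namespace GoodModel

variable {C : Curve K} {𝔭 : HeightOneSpectrum (𝓞 K)} (M : GoodModel C 𝔭)

theorem specGeneric_lift (P : C.Point) : specGeneric 𝔭 ≫ M.lift P = P.hom ≫ M.gen :=
  (M.exists_lift P).choose_spec.1

theorem redPoint_inclSpecial (P : C.Point) :
    (M.redPoint P).hom ≫ M.inclSpecial = specSpecial 𝔭 ≫ M.lift P :=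
  pullback.lift_fst _ _ _

end GoodModel

theorem isUnit_intCast_localInt {p : ℕ} (𝔭 : PrimesAbove K p) {a : ℤ} (ha : IsCoprime a p) :
    IsUnit (a : LocalInt 𝔭.1) := by
  obtain ⟨u, v, h⟩ := ha
  rw [← IsLocalRing.residue_ne_zero_iff_isUnit, map_intCast]
  intro h0
  have h1 := congrArg (Int.castRingHom (ResField 𝔭.1)) h
  simp [h0, natCast_residue_eq_zero 𝔭] at h1

/-- Since ℤ_(p) is a valuation ring, ψ(P) extends to a ℤ_(p)-point of ℙ¹. Over each local ring at 𝔭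
this extension agrees with the image of the section through P, as both restrict to ψ(P) over K. -/
theorem redMod_mem_goodTuples {C : Curve K} {p : ℕ} (hp : p.Prime)
    (M : ∀ 𝔭 : PrimesAbove K p, GoodModel C 𝔭.1)
    (ψ : C.X ⟶ ProjLine) (Ψ : ∀ 𝔭 : PrimesAbove K p, (M 𝔭).X ⟶ ProjLine)
    (hΨ : ∀ 𝔭, (M 𝔭).gen ≫ Ψ 𝔭 = ψ) {P : C.Point} (hP : P ∈ pointsOverRat C ψ) :
    redMod M P ∈ goodTuples M Ψ := by
  obtain ⟨t, ht⟩ := hP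
  have hpZ : Prime (p : ℤ) := Nat.prime_iff_prime_int.1 hp
  have hprime : (Ideal.span {(p : ℤ)}).IsPrime :=
    (Ideal.span_singleton_prime hpZ.ne_zero).2 hpZ
  have hle : (Ideal.span {(p : ℤ)}).primeCompl ≤ nonZeroDivisors ℤ :=
    Ideal.primeCompl_le_nonZeroDivisors _
  let R := Localization.subalgebra.ofField ℚ (Ideal.span {(p : ℤ)}).primeCompl hle
  have : IsLocalization.AtPrime R (Ideal.span {(p : ℤ)}) :=
    inferInstanceAs (IsLocalization (Ideal.span {(p : ℤ)}).primeCompl R)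
  have : IsDiscreteValuationRing R :=
    IsLocalization.AtPrime.isDiscreteValuationRing_of_dedekind_domain ℤ
      (P := Ideal.span {(p : ℤ)}) (by simpa using hpZ.ne_zero) R
  have hfr : IsFractionRing R ℚ := inferInstance
  obtain ⟨t', ht'⟩ := ProjLine.exists_extension (R := R) t
  have hcop : ∀ y : (Ideal.span {(p : ℤ)}).primeCompl, IsCoprime (y : ℤ) p := fun y =>
    ((Prime.coprime_iff_not_dvd hpZ).2 fun h => y.2 (Ideal.mem_span_singleton.2 h)).symm
  have := Fact.mk hp
  -- Reduction ℤ_(p) → 𝔽_p; the witness `t` built from it is common to all 𝔭.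
  let r : R →+* ZMod p := IsLocalization.lift (M := (Ideal.span {(p : ℤ)}).primeCompl)
    (g := Int.castRingHom (ZMod p)) fun y => by
      obtain ⟨u, v, h⟩ := hcop y
      have h1 := congrArg (Int.castRingHom (ZMod p)) h
      simp only [map_add, map_mul, map_natCast, CharP.cast_eq_zero, mul_zero, add_zero,
        map_one] at h1
      exact IsUnit.of_mul_eq_one_right _ h1
  refine ⟨Spec.map (CommRingCat.ofHom r) ≫ t', fun 𝔭 => ?_⟩
  let e : R →+* LocalInt 𝔭.1 :=
    IsLocalization.lift (M := (Ideal.span {(p : ℤ)}).primeCompl)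
      (g := Int.castRingHom (LocalInt 𝔭.1)) fun y => isUnit_intCast_localInt 𝔭 (hcop y)
  have key : (M 𝔭).lift P ≫ Ψ 𝔭 = Spec.map (CommRingCat.ofHom e) ≫ t' := by
    refine ProjLine.hom_ext_of_fractionField (F := K) ?_
    have h₁ := (M 𝔭).specGeneric_lift P
    rw [specGeneric] at h₁
    rw [reassoc_of% h₁, hΨ, ht, ← ht', ← Spec.map_comp_assoc, ← Spec.map_comp_assoc,
      ← CommRingCat.ofHom_comp, ← CommRingCat.ofHom_comp]
    congr 3
    exact IsLocalization.ringHom_ext (Ideal.span {(p : ℤ)}).primeCompl (Subsingleton.elim _ _)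
  have h₂ := (M 𝔭).redPoint_inclSpecial P
  change ((M 𝔭).redPoint P).hom ≫ _ = _
  rw [reassoc_of% h₂, key, specSpecial, ← Spec.map_comp_assoc, ← Spec.map_comp_assoc,
    ← CommRingCat.ofHom_comp, ← CommRingCat.ofHom_comp]
  congr 3
  -- A ring map out of a localization of ℤ is unique, so the two routes from ℤ_(p) to the residue
  -- field at 𝔭 coincide.
  exact IsLocalization.ringHom_ext (Ideal.span {(p : ℤ)}).primeCompl (Subsingleton.elim _ _)

/-! ### Specialization of rational points -/

/-- A morphism from the spectrum of a local ring factors through the local scheme at the image of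
the closed point. -/
theorem exists_stalk_factorization {X : Scheme.{0}} {R : CommRingCat.{0}} [IsLocalRing R]
    (s : Spec R ⟶ X) {z : X} (hz : s (IsLocalRing.closedPoint R) = z) :
    ∃ φ : X.presheaf.stalk z ⟶ R, IsLocalHom φ.hom ∧ Spec.map φ ≫ X.fromSpecStalk z = s := by
  subst hz
  exact ⟨Scheme.stalkClosedPointTo s, inferInstance, Scheme.Spec_stalkClosedPointTo_fromSpecStalk s⟩

namespace GoodModel

variable {C : Curve K} {𝔭 : HeightOneSpectrum (𝓞 K)} (M : GoodModel C 𝔭)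

instance isClosedImmersion_inclSpecial : IsClosedImmersion M.inclSpecial := by
  have : IsClosedImmersion (specSpecial 𝔭) :=
    IsClosedImmersion.spec_of_surjective _ IsLocalRing.residue_surjective
  exact inferInstanceAs (IsClosedImmersion (pullback.fst M.str (specSpecial 𝔭)))

theorem inclSpecial_str : M.inclSpecial ≫ M.str = M.special.str ≫ specSpecial 𝔭 :=
  pullback.condition

theorem specSpecial_closedPoint :
    specSpecial 𝔭 (IsLocalRing.closedPoint (ResField 𝔭)) =
      IsLocalRing.closedPoint (LocalInt 𝔭) :=
  IsLocalRing.comap_closedPoint (IsLocalRing.residue (LocalInt 𝔭))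

theorem gen_toClosedPoint (P : C.Point) :
    M.gen P.toClosedPoint.1 = M.lift P (specGeneric 𝔭 (IsLocalRing.closedPoint K)) := by
  have h := congrArg (fun f : Spec (.of K) ⟶ M.X => f (IsLocalRing.closedPoint K))
    (M.specGeneric_lift P)
  exact h.symm

theorem inclSpecial_redPoint (P : C.Point) :
    M.inclSpecial (M.redPoint P).toClosedPoint.1 =
      M.lift P (IsLocalRing.closedPoint (LocalInt 𝔭)) := by
  have h := congrArg (fun f : Spec (.of (ResField 𝔭)) ⟶ M.X => f (IsLocalRing.closedPoint _))
    (M.redPoint_inclSpecial P)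
  exact h.trans (congrArg (M.lift P) specSpecial_closedPoint)

/-- The only point of the special fibre on the closure of a rational point is its reduction. -/
theorem eq_redPoint_of_specializes (P : C.Point) (y : M.special.ClosedPoint)
    (h : M.gen P.toClosedPoint.1 ⤳ M.inclSpecial y.1) : y = (M.redPoint P).toClosedPoint := by
  -- A section of a separated morphism has closed image, so the closure of the generic point of the
  -- section stays inside it.
  have : IsClosedImmersion (M.lift P ≫ M.str) := by rw [M.lift_str]; infer_instance
  have : IsClosedImmersion (M.lift P) := IsClosedImmersion.of_comp (M.lift P) M.str
  have hmem : M.inclSpecial y.1 ∈ Set.range (M.lift P) := by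
    refine h.mem_closed (M.lift P).isClosedEmbedding.isClosed_range ?_
    rw [gen_toClosedPoint]
    exact Set.mem_range_self _
  obtain ⟨r, hr⟩ := hmem
  have h₁ : M.str (M.lift P r) = r :=
    congrArg (fun f : Spec (.of (LocalInt 𝔭)) ⟶ _ => f r) (M.lift_str P)
  have h₂ : M.str (M.inclSpecial y.1) = IsLocalRing.closedPoint (LocalInt 𝔭) := by
    have h := congrArg (fun f : M.special.X ⟶ _ => f y.1) M.inclSpecial_str
    simp only [Scheme.Hom.comp_apply] at h
    rw [h, ← specSpecial_closedPoint]
    exact congrArg (specSpecial 𝔭) (Subsingleton.elim (α := PrimeSpectrum (ResField 𝔭)) _ _)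
  have hr' : r = IsLocalRing.closedPoint (LocalInt 𝔭) := by rw [← h₁, hr, h₂]
  refine Subtype.ext (M.inclSpecial.isClosedEmbedding.injective ?_)
  rw [inclSpecial_redPoint, ← hr, hr']

theorem specializes_redPoint (P : C.Point) :
    M.gen P.toClosedPoint.1 ⤳ M.inclSpecial (M.redPoint P).toClosedPoint.1 := by
  rw [gen_toClosedPoint, inclSpecial_redPoint]
  exact (IsLocalRing.specializes_closedPoint (R := LocalInt 𝔭) _).map (M.lift P).continuous

/-- The ideal of the closure of a rational point is the kernel of the restriction to the
corresponding section. -/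
theorem closureIdeal_eq_ker (P : C.Point) {z : M.X} (h : M.gen P.toClosedPoint.1 ⤳ z)
    (φ : M.X.presheaf.stalk z ⟶ CommRingCat.of (LocalInt 𝔭))
    (hφ : Spec.map φ ≫ M.X.fromSpecStalk z = M.lift P) :
    M.closureIdeal P.toClosedPoint.1 z = RingHom.ker φ.hom := by
  -- Both sides are the prime of the local ring at `z` corresponding to the image of P in the model.
  have key : Spec.map (M.X.presheaf.stalkSpecializes h) (IsLocalRing.closedPoint _) =
      Spec.map φ (specGeneric 𝔭 (IsLocalRing.closedPoint K)) := by
    refine (M.X.fromSpecStalk z).isEmbedding.injective ?_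
    have h₁ := congrArg (fun f : Spec (M.X.presheaf.stalk (M.gen P.toClosedPoint.1)) ⟶ M.X =>
      f (IsLocalRing.closedPoint _)) (Scheme.SpecMap_stalkSpecializes_fromSpecStalk h)
    have h₂ := congrArg (fun f : Spec (.of (LocalInt 𝔭)) ⟶ M.X =>
      f (specGeneric 𝔭 (IsLocalRing.closedPoint K))) hφ
    exact h₁.trans (Scheme.fromSpecStalk_closedPoint.trans
      ((M.gen_toClosedPoint P).trans h₂.symm))
  have h' := congrArg PrimeSpectrum.asIdeal key
  rw [closureIdeal, dif_pos h]
  refine h'.trans ?_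
  ext a
  change algebraMap (LocalInt 𝔭) K (φ.hom a) ∈ IsLocalRing.maximalIdeal K ↔ φ.hom a = 0
  rw [IsLocalRing.maximalIdeal_eq_bot, Ideal.mem_bot,
    map_eq_zero_iff _ (IsFractionRing.injective (LocalInt 𝔭) K)]

/-- This is transversality. The section splits the structure map, so modulo its ideal every function
is a constant from the base; a function vanishing at the reduced point has its constant in the
maximal ideal, which dies on the special fibre. -/
theorem map_closureIdeal_redPoint (P : C.Point) :
    (M.closureIdeal P.toClosedPoint.1 (M.inclSpecial (M.redPoint P).toClosedPoint.1)).map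
      (M.inclSpecial.stalkMap (M.redPoint P).toClosedPoint.1).hom =
    IsLocalRing.maximalIdeal (M.special.X.presheaf.stalk (M.redPoint P).toClosedPoint.1) := by
  obtain ⟨φ, hφloc, hφ⟩ := exists_stalk_factorization (R := .of (LocalInt 𝔭)) (M.lift P)
    (M.inclSpecial_redPoint P).symm
  obtain ⟨ρ, hρloc, hρ⟩ := exists_stalk_factorization (R := .of (ResField 𝔭)) (M.redPoint P).hom
    (z := (M.redPoint P).toClosedPoint.1) rfl
  rw [M.closureIdeal_eq_ker P (M.specializes_redPoint P) φ hφ]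
  generalize (M.redPoint P).toClosedPoint.1 = y at *
  -- Here `α` and `β` are the structure maps of the two stalks, and `φ` and `ρ` evaluate at the
  -- section and at the reduced point.
  obtain ⟨α, hα⟩ := Spec.map_surjective (M.X.fromSpecStalk (M.inclSpecial y) ≫ M.str)
  obtain ⟨β, hβ⟩ := Spec.map_surjective (M.special.X.fromSpecStalk y ≫ M.special.str)
  have hαφ : α ≫ φ = 𝟙 _ := by
    apply Spec.map_injective
    rw [Spec.map_comp, hα, reassoc_of% hφ, M.lift_str, Spec.map_id]
  have hαβ : α ≫ M.inclSpecial.stalkMap y =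
      CommRingCat.ofHom (IsLocalRing.residue (LocalInt 𝔭)) ≫ β := by
    apply Spec.map_injective
    rw [Spec.map_comp, Spec.map_comp, hα, hβ, ← Category.assoc,
      Scheme.SpecMap_stalkMap_fromSpecStalk, Category.assoc, Category.assoc, M.inclSpecial_str]
  have hφρ : M.inclSpecial.stalkMap y ≫ ρ =
      φ ≫ CommRingCat.ofHom (IsLocalRing.residue (LocalInt 𝔭)) := by
    apply Spec.map_injective
    rw [← cancel_mono (M.X.fromSpecStalk (M.inclSpecial y)), Spec.map_comp, Spec.map_comp,
      Category.assoc, Category.assoc, hφ, Scheme.SpecMap_stalkMap_fromSpecStalk, reassoc_of% hρ,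
      M.redPoint_inclSpecial]
  apply le_antisymm
  · rw [Ideal.map_le_iff_le_comap]
    intro a ha
    rw [Ideal.mem_comap, IsLocalRing.mem_maximalIdeal, mem_nonunits_iff]
    intro hu
    have h := congrArg (fun f => f.hom a) hφρ
    have hu' := hu.map ρ.hom
    rw [show ρ.hom ((M.inclSpecial.stalkMap y).hom a) = 0 from
      h.trans (by simp [(RingHom.mem_ker).1 ha])] at hu'
    exact not_isUnit_zero hu'
  · intro g hg
    obtain ⟨a, rfl⟩ := M.inclSpecial.stalkMap_surjective y g
    have hρa : ρ.hom ((M.inclSpecial.stalkMap y).hom a) = 0 := by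
      by_contra hne
      exact (IsLocalRing.mem_maximalIdeal _).1 hg
        (isUnit_of_map_unit ρ.hom _ (isUnit_iff_ne_zero.2 hne))
    have hres : IsLocalRing.residue (LocalInt 𝔭) (φ.hom a) = 0 :=
      (congrArg (fun f => f.hom a) hφρ).symm.trans hρa
    -- Subtracting the constant `φ a` moves `a` into the ideal of the section without changing its
    -- image `g`.
    have hker : a - α.hom (φ.hom a) ∈ RingHom.ker φ.hom := by
      rw [RingHom.mem_ker, map_sub,
        show φ.hom (α.hom (φ.hom a)) = φ.hom a from congrArg (fun f => f.hom (φ.hom a)) hαφ,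
        sub_self]
    have hzero : (M.inclSpecial.stalkMap y).hom (α.hom (φ.hom a)) = 0 :=
      (congrArg (fun f => f.hom (φ.hom a)) hαβ).trans
        ((congrArg β.hom hres).trans (map_zero β.hom))
    have h := Ideal.mem_map_of_mem (M.inclSpecial.stalkMap y).hom hker
    rwa [map_sub, hzero, sub_zero] at h

open Classical in
-- At the reduced point the quotient is the residue field, of length one; elsewhere the closure
-- ideal is the unit ideal.
theorem mult_toClosedPoint (P : C.Point) (y : M.special.ClosedPoint) :
    M.mult P.toClosedPoint y = if y = (M.redPoint P).toClosedPoint then 1 else 0 := by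
  split_ifs with hy
  · subst hy
    rw [mult, M.map_closureIdeal_redPoint P]
    have : IsSimpleModule
        (M.special.X.presheaf.stalk (M.redPoint P).toClosedPoint.1)
        (M.special.X.presheaf.stalk (M.redPoint P).toClosedPoint.1 ⧸
          IsLocalRing.maximalIdeal
            (M.special.X.presheaf.stalk (M.redPoint P).toClosedPoint.1)) :=
      isSimpleModule_iff_isCoatom.2 (IsLocalRing.maximalIdeal.isMaximal _).out
    rw [Module.length_eq_one]
    rfl
  · rw [mult, closureIdeal, dif_neg fun h => hy (M.eq_redPoint_of_specializes P y h),
      Ideal.map_top, Module.length_eq_zero_iff.2 (Submodule.Quotient.subsingleton_iff.2 rfl)]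
    rfl

/-- Reduction is compatible with the Abel-Jacobi map. -/
theorem abelJacobi_mem_redGraph (Q P : C.Point) :
    (Curve.abelJacobi Q P, Curve.abelJacobi (M.redPoint Q) (M.redPoint P)) ∈ M.redGraph := by
  classical
  refine ⟨_, _, fun y => ?_, rfl, rfl⟩
  rw [Finsupp.sum_sub_index (h := fun x n => n * (M.mult x y : ℤ)) fun _ _ _ => by ring]
  simp [mult_toClosedPoint, Finsupp.single_apply, eq_comm]

end GoodModel

/-! ### The sieve -/

theorem exists_mem_sieveSet {A : Type} [AddCommGroup A] {b : ℕ} {B : Fin (b + 1) → Type}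
    [∀ i, AddCommGroup (B i)] (L : AddSubgroup A) (Γ : ∀ i, AddSubgroup (A × B i))
    (w : L) (y : ∀ i, B i) (S : ∀ i, Set (B i)) (hy : ∀ i, y i ∈ S i)
    (hw : ∀ i, ((w : A), y i) ∈ Γ i) (i : Fin (b + 1)) :
    (QuotientAddGroup.mk w : L ⧸ (sieveSubgroup L Γ i).addSubgroupOf L) ∈
      sieveSet L Γ (y 0) S i := by
  induction i using Fin.induction with
  | zero => exact ⟨w, rfl, hw 0⟩
  | succ i ih =>
    refine ⟨w, 0, ih, zero_mem _, by rw [add_zero], y i.succ, hy _, ?_⟩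
    rw [add_zero]
    exact hw _

/-- If the orders of the groups `B i` are coprime to the index of `L`, every element of `A` has a
multiple in `L` with the same images in the `B i`. -/
theorem exists_mem_of_coprime_index {A : Type} [AddCommGroup A] {b : ℕ} {B : Fin (b + 1) → Type}
    [∀ i, AddCommGroup (B i)] (L : AddSubgroup A) (Γ : ∀ i, AddSubgroup (A × B i))
    (hcop : ∀ i, Nat.Coprime (Nat.card (B i)) L.index) (a : A) (y : ∀ i, B i)
    (ha : ∀ i, (a, y i) ∈ Γ i) : ∃ w : L, ∀ i, ((w : A), y i) ∈ Γ i := by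
  have h : Nat.Coprime (∏ i, Nat.card (B i)) L.index := Nat.Coprime.prod_left fun i _ => hcop i
  obtain ⟨u, v, huv⟩ := Nat.isCoprime_iff_coprime.2 h
  refine ⟨⟨v • L.index • a, L.zsmul_mem (L.nsmul_index_mem a) v⟩, fun i => ?_⟩
  have hi : v • L.index • y i = y i := by
    obtain ⟨c, hc⟩ := Finset.dvd_prod_of_mem (fun i => Nat.card (B i)) (Finset.mem_univ i)
    have h0 : (∏ i, Nat.card (B i)) • y i = 0 := by
      -- Finiteness of `B i` is not needed: `Nat.card` of an infinite group is 0, which also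
      -- annihilates.
      rw [hc, mul_nsmul, card_nsmul_eq_zero', nsmul_zero]
    calc v • L.index • y i
        = u • (∏ i, Nat.card (B i)) • y i + v • L.index • y i := by rw [h0, zsmul_zero, zero_add]
      _ = (u * (∏ i, Nat.card (B i) : ℕ) + v * L.index) • y i := by
        rw [add_zsmul, mul_zsmul, mul_zsmul, natCast_zsmul, natCast_zsmul]
      _ = y i := by rw [huv, one_zsmul]
  have hmem := (Γ i).zsmul_mem ((Γ i).nsmul_mem (ha i) L.index) v
  rwa [Prod.smul_mk, Prod.smul_mk, hi] at hmem

end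

theorem mainTheorem5 {K : Type} [Field K] [NumberField K]
    (C : Curve K) (Q : C.Point) (ψ : C.X ⟶ ProjLine)
    (L : AddSubgroup C.Jac) (N : ℕ) (hN : N ≠ 0) (hL : L.index = N)
    (b : ℕ) (p : Fin (b + 1) → ℕ) (hp : ∀ i, (p i).Prime)
    (hunram : ∀ i, ∀ 𝔭 : PrimesAbove K (p i), 𝔭.1.asIdeal.ramificationIdx ℤ = 1)
    (M : ∀ i, ∀ 𝔭 : PrimesAbove K (p i), GoodModel C 𝔭.1)
    (Ψ : ∀ i, ∀ 𝔭 : PrimesAbove K (p i), (M i 𝔭).X ⟶ ProjLine)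
    (hΨ : ∀ i 𝔭, (M i 𝔭).gen ≫ Ψ i 𝔭 = ψ)
    (hcop : ∀ i, Nat.Coprime (Nat.card (JacMod (M i))) N)
    (𝓟 : PointsMod (M 0)) (h𝓟 : 𝓟 ∈ goodTuples (M 0) (Ψ 0))
    (hW : sieveSet L (fun i => redGraphMod (M i)) (abelJacobiMod (M 0) Q 𝓟)
      (fun i => abelJacobiMod (M i) Q '' goodTuples (M i) (Ψ i)) (Fin.last b) = ∅) :
    residueClass (M 0) 𝓟 ∩ pointsOverRat C ψ = ∅ := by
  rw [Set.eq_empty_iff_forall_notMem]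
  rintro P ⟨rfl, hP⟩
  obtain ⟨w, hw⟩ := exists_mem_of_coprime_index L (fun i => redGraphMod (M i))
    (fun i => hL ▸ hcop i) (Curve.abelJacobi Q P) (fun i => abelJacobiMod (M i) Q (redMod (M i) P))
    fun i 𝔭 => (M i 𝔭).abelJacobi_mem_redGraph Q P
  have h := exists_mem_sieveSet L (fun i => redGraphMod (M i)) w _
    (fun i => abelJacobiMod (M i) Q '' goodTuples (M i) (Ψ i))
    (fun i => Set.mem_image_of_mem _ (redMod_mem_goodTuples (hp i) (M i) ψ (Ψ i) (hΨ i) hP)) hw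
    (Fin.last b)
  rw [hW] at h
  exact h
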